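/- For an endomorphism $\psi$ of an abelian group $G$ (written additively), the Reidemeister number $R(\psi)$ is the number of classes of the relation $\alpha\sim\beta\iff \beta=g+\alpha-\psi(g)$ for some $g\in G$. Let $R=\mathbb{Z}[t]$. **Theorem.** Let $G$ be a torsion abelian group of bounded exponent (that is, $NG=0$ for some integer $N\ge 1$) which is not finitely generated, and let $\phi$ be an automorphism of $G$. Regard $G$ as an $R$-module with $t$ acting as $\phi$. Suppose that 1. the set $\mathrm{Ass}(G)$ of associated primes of the $R$-module $G$ is finite and consists of non-zero principal ideals; 2. for every $j\ge 1$ the map $g\mapsto (t^j-1)g$ is injective on $G$; 3. for every $\mathfrak p\in \mathrm{Ass}(G)$ one has $\dim_{\mathbb K(\mathfrak p)} \bigl(G\otimes_R\mathbb K(\mathfrak p)\bigr)<\infty$, where $\mathbb K(\mathfrak p)$ is the field of fractions of $R/\mathfrak p$. (Every Noetherian $R$-module whose additive group is torsion has bounded exponent.) Then there exist an integer $n\ge 0$, rational function fields $\mathbb K_i=\mathbb F_{p(i)}(t)$ with $p(i)$ prime ($1\le i\le n$), sets $P_i$ of finite places of $\mathbb K_i$, sets $P_i^\infty$ of infinite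 places of $\mathbb K_i$, and sets $S_i=\mathcal P(\mathbb K_i)\setminus(P_i^\infty\cup P_i)$ consisting of finite places, such that for every integer $j\ge 1$ the number $R(\phi^j)$ is finite and $$R(\phi^j)=\prod_{i=1}^n\prod_{v\in P_i}|t^j-1|_v^{-1}=\prod_{i=1}^n|t^j-1|_{P_i}^{-1}=\prod_{i=1}^n|t^j-1|_{P_i^\infty\cup S_i}.$$ Here $\mathcal P(\mathbb K)$ is the set of all places of $\mathbb K=\mathbb F_p(t)$, each identified with its valuation ring, a discrete valuation ring with fraction field $\mathbb K$; a place is finite if its valuation ring contains $\mathbb F_p[t]$, and infinite otherwise. $|x|_v=|\mathcal R_v|^{-v(x)}$ is the normalised absolute value, where $v$ also denotes the valuation with value group $\mathbb Z$ and $\mathcal R_v$ is the residue field, and $|x|_S=\prod_{v\in S}|x|_v$; for $x=t^j-1$ all but finitely many factors are $1$. -/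

import Mathlib

open Polynomial

noncomputable section

/-! ### Twisted conjugacy classes and Reidemeister numbers -/

/-- Twisted conjugacy (in additive notation) with respect to an endomorphism `φ`:
`α ∼ β` iff `β = g + α + φ (-g)` for some `g`. -/
def twistedConj {G : Type*} [AddGroup G] (φ : AddMonoid.End G) : Setoid G where
  r α β := ∃ g : G, β = g + α + φ (-g)
  iseqv :=
    { refl := fun α => ⟨0, by simp⟩
      symm := by
        rintro α β ⟨g, rfl⟩
        exact ⟨-g, by simp [add_assoc]⟩
      trans := by
        rintro α β γ ⟨g, rfl⟩ ⟨h, rfl⟩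
        exact ⟨h + g, by simp [add_assoc]⟩ }

/-- The set of `φ`-twisted conjugacy classes. -/
abbrev ReidemeisterClass {G : Type*} [AddGroup G] (φ : AddMonoid.End G) : Type _ :=
  Quotient (twistedConj φ)

/-- The Reidemeister number of `φ`, i.e. the number of twisted conjugacy classes, in `ℕ∞`. -/
def reidemeisterNumber {G : Type*} [AddGroup G] (φ : AddMonoid.End G) : ℕ∞ :=
  ENat.card (ReidemeisterClass φ)

/-! ### The `ℤ[t]`-module attached to an endomorphism of an abelian group -/

/-- The abelian group `G` as a `ℤ[t]`-module, with `t` acting as `φ`. -/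
abbrev PolyModule {G : Type*} [AddCommGroup G] (φ : AddMonoid.End G) : Type _ :=
  Module.AEval' (addMonoidEndRingEquivInt G φ)

/-! ### Places and normalised absolute values -/

/-- A place of a (global function) field `K`, i.e. an equivalence class of nontrivial absolute
values, represented by its valuation ring `{x | |x| ≤ 1}`, a discrete valuation ring with
fraction field `K`. -/
@[ext]
structure Place (K : Type*) [Field K] where
  /-- the valuation ring of the place -/
  ring : ValuationSubring K
  isDVR : IsDiscreteValuationRing ring

attribute [instance] Place.isDVR

namespace Place

variable {K : Type*} [Field K]

/-- The residue class field of the place. -/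
abbrev residueField (v : Place K) : Type _ := IsLocalRing.ResidueField v.ring

/-- The additive valuation of the place with value group exactly `ℤ`
(with junk value `0` at `x = 0`). -/
def ord (v : Place K) (x : K) : ℤ :=
  -WithZero.log ((IsDiscreteValuationRing.maximalIdeal v.ring).valuation K x)

open Classical in
/-- The normalised absolute value `|x|_v = |residue field| ^ (-v(x))`, with `|0|_v = 0`. -/
def abs (v : Place K) (x : K) : ℝ :=
  if x = 0 then 0 else (Nat.card v.residueField : ℝ) ^ (-v.ord x)

/-- `|x|_S = ∏_{v ∈ S} |x|_v`. (For `x ≠ 0` in a global field almost all factors are `1`.) -/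
def absOn (S : Set (Place K)) (x : K) : ℝ := ∏ᶠ v ∈ S, v.abs x

/-- A place of `k(t)` is finite if it comes from a nonzero prime ideal of `k[t]`,
i.e. if its valuation ring contains the image of `k[t]`. -/
def IsFinite {k : Type*} [Field k] (v : Place (RatFunc k)) : Prop :=
  ∀ f : k[X], algebraMap k[X] (RatFunc k) f ∈ v.ring

/-- A place of `k(t)` is infinite if it is not finite. -/
def IsInfinite {k : Type*} [Field k] (v : Place (RatFunc k)) : Prop := ¬ v.IsFinite

end Place

end

/-! Twisted classes of `φ ^ j` are the cosets of the image of `φ ^ j - 1`, so the Reidemeister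
number is the order of the cokernel of `t ^ j - 1` on the `ℤ[t]`-module `M` attached to `G`. By the
snake lemma these orders multiply in short exact sequences on whose quotient `t ^ j - 1` is
injective (`cokerCard_eq_ker_mul`), so `M` may be cut into simple pieces.

As associated primes are principal, the annihilator of a nonzero `p`-torsion element lies in `(p)`;
hence `M[p]` is torsion-free over `𝔽_p[t]`. Condition (3) and the bounded exponent make its rank
finite (`hasFiniteRankTorsion`). The sequences `0 → M[p] → M → pM → 0` then allow induction on the
exponent, and saturations of cyclic submodules reduce `M[p]` to modules `L` of rank at most one.

For such `L` and an irreducible `π`, the quotient `L/πL` is either `0` or of the order of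
`𝔽_p[t]/π`. Multiplicativity in the polynomial gives `|L/fL| = ∏ |f|_q⁻¹` over the primes `q` whose
generator is not surjective on `L` (`cokerCard_eq_finprod`); these primes form one `P_i`. The
expression through `P_i^∞ ∪ S_i` follows from the product formula `absOn_univ`.

The identities for `cokerCard` need no finiteness, an infinite index being `0`. Finiteness is read
off at the end from the non-vanishing of the product. -/

/-- The cardinality of the cokernel of multiplication by `r` on `M` (`0` if infinite). -/
noncomputable def cokerCard {R : Type*} [Ring R] (M : Type*) [AddCommGroup M] [Module R M]
    (r : R) : ℕ :=
  (DistribSMul.toAddMonoidHom M r).range.index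

/-! ### Multiplicativity of cokernel orders -/

section cokerCard

variable {R : Type*} [CommRing R] {M : Type*} [AddCommGroup M] [Module R M]

theorem cokerCard_eq_one_of_surjective {r : R} (h : Function.Surjective fun m : M => r • m) :
    cokerCard M r = 1 :=
  AddSubgroup.index_eq_one.2 (AddMonoidHom.range_eq_top.2 h)

/-- In the chain `rsM ≤ rM ≤ M`, injectivity of `r` identifies `rM/rsM` with `M/sM`. -/
theorem cokerCard_mul {r : R} (hr : Function.Injective fun m : M => r • m) (s : R) :
    cokerCard M (r * s) = cokerCard M r * cokerCard M s := by
  have hmap : (DistribSMul.toAddMonoidHom M (r * s)).range =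
      (DistribSMul.toAddMonoidHom M s).range.map (DistribSMul.toAddMonoidHom M r) := by
    ext x
    simp [mul_smul]
  rw [cokerCard, cokerCard, cokerCard, hmap, AddSubgroup.index_map_of_injective _ hr, mul_comm]

/-- Multiplicativity of `cokerCard` in short exact sequences. -/
theorem cokerCard_eq_ker_mul {Q : Type*} [AddCommGroup Q] [Module R Q] (q : M →ₗ[R] Q)
    (hq : Function.Surjective q) {r : R} (hr : Function.Injective fun m : Q => r • m) :
    cokerCard M r = cokerCard (LinearMap.ker q) r * cokerCard Q r := by
  set H := (DistribSMul.toAddMonoidHom M r).range with hH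
  set K : AddSubgroup M := q.toAddMonoidHom.ker with hK
  have h1 : (H ⊔ K).index = cokerCard Q r := by
    have : (DistribSMul.toAddMonoidHom Q r).range.comap q.toAddMonoidHom = H ⊔ K := by
      rw [hK, ← AddSubgroup.comap_map_eq]
      congr 1
      ext x
      constructor
      · rintro ⟨y, rfl⟩
        obtain ⟨z, rfl⟩ := hq y
        exact ⟨r • z, ⟨z, rfl⟩, by simp⟩
      · rintro ⟨_, ⟨z, rfl⟩, rfl⟩
        exact ⟨q z, by simp⟩
    rw [← this]
    exact AddSubgroup.index_comap_of_surjective _ hq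
  have h2 : H.relIndex K = cokerCard (LinearMap.ker q) r := by
    have : H.addSubgroupOf K =
        (DistribSMul.toAddMonoidHom (LinearMap.ker q) r).range := by
      ext ⟨x, hx⟩
      simp only [AddSubgroup.mem_addSubgroupOf, hH, AddMonoidHom.mem_range]
      constructor
      · rintro ⟨y, hy⟩
        -- If `r • y` lies in the kernel of `q`, then so does `y`, because `r` is injective on `Q`.
        refine ⟨⟨y, hr ?_⟩, Subtype.ext hy⟩
        have hx' : q x = 0 := hx
        have hy' : r • y = x := hy
        change r • q y = r • 0
        rw [← map_smul, hy', hx', smul_zero]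
      · rintro ⟨y, hy⟩
        exact ⟨y, congrArg Subtype.val hy⟩
    rw [AddSubgroup.relIndex, this]
    rfl
  rw [← h1, ← h2, ← AddSubgroup.relIndex_sup_left,
    AddSubgroup.relIndex_mul_index le_sup_left]
  rfl

theorem smul_injective_of_eq_zero_of_smul {r : R}
    (h : ∀ m : M, r • m = 0 → m = 0) : Function.Injective fun m : M => r • m := by
  intro x y hxy
  refine sub_eq_zero.1 (h _ ?_)
  rw [smul_sub, sub_eq_zero]
  exact hxy

end cokerCard

/-! ### Torsion-free modules of rank at most one over a PID -/

section RankOne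

variable {A : Type*} [CommRing A] [IsDomain A] [IsPrincipalIdealRing A]
  {M : Type*} [AddCommGroup M] [Module A M]

/-- A torsion-free module of rank at most one: it has no torsion and any two elements are
linearly dependent. -/
structure IsRankLEOne (A : Type*) [CommRing A] (M : Type*) [AddCommGroup M] [Module A M] :
    Prop where
  eq_zero_of_smul : ∀ (a : A) (m : M), a ≠ 0 → a • m = 0 → m = 0
  exists_smul_eq : ∀ x y : M, ∃ a b : A, (a ≠ 0 ∨ b ≠ 0) ∧ a • x = b • y

theorem IsRankLEOne.exists_isCoprime (h : IsRankLEOne A M) (x y : M) :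
    ∃ a b : A, IsCoprime a b ∧ a • x = b • y := by
  obtain ⟨a, b, hab, e⟩ := h.exists_smul_eq x y
  classical
  let := IsBezout.toGCDDomain A
  have hg : gcd a b ≠ 0 := by
    rw [Ne, gcd_eq_zero_iff]
    tauto
  obtain ⟨a', b', ha, hb, hu⟩ := extract_gcd a b
  refine ⟨a', b', (gcd_isUnit_iff a' b').1 hu, ?_⟩
  refine smul_injective_of_eq_zero_of_smul (r := gcd a b) (h.eq_zero_of_smul _ · hg) ?_
  simp only [smul_smul]
  rw [← ha, ← hb, e]

/-- For `x` outside `πM`, the map `a ↦ a • x` induces an isomorphism from `A/π` to `M/πM`: a coprime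
relation `a • x = b • y` has `π ∤ b`, so `b` is invertible modulo `π` and `y` is a multiple of `x`
modulo `πM`. -/
theorem IsRankLEOne.cokerCard_eq_card_quotient (h : IsRankLEOne A M) {π : A} (hπ : Irreducible π)
    (hs : ¬ Function.Surjective fun m : M => π • m) :
    cokerCard M π = Nat.card (A ⧸ Ideal.span {π}) := by
  simp only [Function.Surjective, not_forall, not_exists] at hs
  obtain ⟨x, hx⟩ := hs
  -- Bézout: `u * π + v * a = 1`, so `v` inverts `a` modulo `π`.
  have key : ∀ a : A, ¬ π ∣ a → ∀ z : M, ∃ b : A, ∃ w : M, z = (b * a) • z + π • w := by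
    intro a ha z
    obtain ⟨u, v, huv⟩ := (hπ.coprime_iff_not_dvd.2 ha)
    exact ⟨v, u • z, by rw [smul_smul, ← add_smul, mul_comm π u, add_comm, huv, one_smul]⟩
  let f : A →+ M ⧸ (DistribSMul.toAddMonoidHom M π).range :=
    (QuotientAddGroup.mk' _).comp ((LinearMap.toSpanSingleton A M x).toAddMonoidHom)
  have hfk : ∀ a : A, f a = 0 ↔ a ∈ (Ideal.span {π} : Ideal A) := by
    intro a
    rw [Ideal.mem_span_singleton]
    change (QuotientAddGroup.mk (a • x) : M ⧸ (DistribSMul.toAddMonoidHom M π).range) = 0 ↔ _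
    rw [QuotientAddGroup.eq_zero_iff]
    constructor
    · rintro ⟨y, hy⟩
      by_contra hd
      have hy' : π • y = a • x := hy
      obtain ⟨b, w, e⟩ := key a hd x
      refine hx (b • y + w) ?_
      rw [smul_add, smul_comm π b, hy', smul_smul, ← e]
    · rintro ⟨b, rfl⟩
      exact ⟨b • x, by simp [mul_smul]⟩
  have hfs : Function.Surjective f := by
    intro y
    obtain ⟨y, rfl⟩ := QuotientAddGroup.mk_surjective y
    obtain ⟨a, b, hab, e⟩ := h.exists_isCoprime x y
    have hb : ¬ π ∣ b := by
      rintro ⟨c, rfl⟩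
      have ha : ¬ π ∣ a := fun ha => hπ.not_isUnit
        (hab.isUnit_of_dvd' ha (dvd_mul_right _ _))
      have : a ∈ (Ideal.span {π} : Ideal A) := by
        rw [← hfk]
        change (QuotientAddGroup.mk (a • x) : M ⧸ (DistribSMul.toAddMonoidHom M π).range) = 0
        rw [QuotientAddGroup.eq_zero_iff]
        exact ⟨c • y, by rw [e, mul_smul]; rfl⟩
      exact ha (Ideal.mem_span_singleton.1 this)
    obtain ⟨c, w, ew⟩ := key b hb y
    refine ⟨c * a, ?_⟩
    change (QuotientAddGroup.mk ((c * a) • x) : M ⧸ (DistribSMul.toAddMonoidHom M π).range) = _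
    rw [QuotientAddGroup.eq]
    refine ⟨w, ?_⟩
    change π • w = _
    rw [mul_smul, e, ← mul_smul]
    nth_rewrite 2 [ew]
    abel
  have hker : f.ker = (Ideal.span {π} : Ideal A).toAddSubgroup := by
    ext a
    exact hfk a
  rw [cokerCard, AddSubgroup.index_eq_card,
    ← Nat.card_congr (QuotientAddGroup.quotientKerEquivOfSurjective f hfs).toEquiv, hker]
  rfl

end RankOne

/-! ### Places and their normalised valuations -/

open WithZero IsDedekindDomain in
/-- Equivalent surjective valuations with values in `ℤᵐ⁰` are equal. -/
theorem Valuation.IsEquiv.eq_of_surjective {K : Type*} [Field K] {v w : Valuation K ℤᵐ⁰}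
    (h : v.IsEquiv w) (hv : Function.Surjective v) (hw : Function.Surjective w) : v = w := by
  obtain ⟨ϖ, hϖ⟩ := hv (exp (-1))
  obtain ⟨ρ, hρ⟩ := hw (exp (-1))
  -- `exp (-1)` is the largest value below `1`; this makes a uniformizer of `v` one of `w` too.
  have lt_one : ∀ x : ℤᵐ⁰, x < 1 ↔ x ≤ exp (-1) := by
    intro x
    induction x using WithZero.expRecOn with
    | zero => simp
    | exp n => rw [← exp_zero, exp_lt_exp, exp_le_exp]; omega
  have hwϖ : w ϖ = exp (-1) := by
    apply le_antisymm
    · rw [← lt_one, ← h.lt_one_iff_lt_one, lt_one, hϖ]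
    · rw [← hρ, ← h.le_iff_le, hϖ, ← lt_one, h.lt_one_iff_lt_one, lt_one, hρ]
  ext x
  by_cases hx : x = 0
  · simp [hx]
  obtain ⟨n, hn⟩ : ∃ n : ℤ, v x = exp n := ⟨log (v x), (exp_log (by simpa using hx)).symm⟩
  have h1 : v (x * ϖ ^ n) = 1 := by
    rw [map_mul, map_zpow₀, hϖ, hn, ← exp_zsmul, ← exp_add]; simp
  have h2 := h.eq_one_iff_eq_one.1 h1
  rw [map_mul, map_zpow₀, hwϖ, ← exp_zsmul] at h2
  rw [hn, eq_inv_of_mul_eq_one_left h2, ← exp_neg]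
  simp

namespace Place

open WithZero IsDedekindDomain

variable {K : Type*} [Field K]

/-- The normalised `ℤᵐ⁰`-valued valuation attached to a place. -/
noncomputable def val (v : Place K) : Valuation K ℤᵐ⁰ :=
  (IsDiscreteValuationRing.maximalIdeal v.ring).valuation K

instance (v : Place K) : v.val.IsRankOneDiscrete :=
  inferInstanceAs ((IsDiscreteValuationRing.maximalIdeal v.ring).valuation K).IsRankOneDiscrete

theorem val_surjective (v : Place K) : Function.Surjective v.val :=
  HeightOneSpectrum.valuation_surjective _ _

theorem val_le_one_iff (v : Place K) (x : K) : v.val x ≤ 1 ↔ x ∈ v.ring := by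
  constructor
  · intro h
    obtain ⟨a, rfl⟩ := IsDiscreteValuationRing.exists_lift_of_le_one h
    exact a.2
  · intro h
    exact HeightOneSpectrum.valuation_le_one _ (⟨x, h⟩ : v.ring)

theorem valuationSubring_val (v : Place K) : v.val.valuationSubring = v.ring :=
  SetLike.ext fun x => v.val_le_one_iff x

theorem abs_of_ne_zero (v : Place K) {x : K} (hx : x ≠ 0) :
    v.abs x = (Nat.card v.residueField : ℝ) ^ log (v.val x) := by
  rw [Place.abs, if_neg hx, Place.ord, neg_neg]
  rfl

theorem abs_mul (v : Place K) {x y : K} (hx : x ≠ 0) (hy : y ≠ 0)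
    (hc : Nat.card v.residueField ≠ 0) : v.abs (x * y) = v.abs x * v.abs y := by
  rw [v.abs_of_ne_zero hx, v.abs_of_ne_zero hy, v.abs_of_ne_zero (mul_ne_zero hx hy), map_mul,
    log_mul (by simpa using hx) (by simpa using hy), zpow_add₀ (by exact_mod_cast hc)]

/-- The place attached to a surjective valuation with values in `ℤᵐ⁰`. -/
def ofValuation (w : Valuation K ℤᵐ⁰) (hw : Function.Surjective w) : Place K where
  ring := w.valuationSubring
  isDVR := by
    have : Nontrivial (MonoidWithZeroHom.valueGroup (.ofClass w)) := by
      obtain ⟨x, hx⟩ := hw (exp 1)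
      rw [Subgroup.nontrivial_iff_exists_ne_one]
      refine ⟨Units.mk0 (w x) (by simp [hx]), MonoidWithZeroHom.mem_valueGroup _ ⟨x, rfl⟩, ?_⟩
      intro h
      have := congrArg Units.val h
      rw [Units.val_mk0, hx, Units.val_one, ← exp_zero, exp_inj] at this
      omega
    infer_instance

/-- A place remembers only the valuation ring, hence the valuation up to equivalence; surjectivity
onto `ℤᵐ⁰` removes the remaining ambiguity. -/
theorem val_ofValuation (w : Valuation K ℤᵐ⁰) (hw : Function.Surjective w) :
    (ofValuation w hw).val = w := by
  refine Valuation.IsEquiv.eq_of_surjective ?_ (val_surjective _) hw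
  rw [Valuation.isEquiv_iff_valuationSubring, valuationSubring_val]
  rfl

theorem ofValuation_eq {v : Place K} {w : Valuation K ℤᵐ⁰} (hw : Function.Surjective w)
    (h : v.val.IsEquiv w) : ofValuation w hw = v := by
  refine Place.ext ?_
  rw [← v.valuationSubring_val, (Valuation.isEquiv_iff_valuationSubring _ _).1 h]
  rfl

/-- The residue field of a place is the quotient of any subring dense modulo the
maximal ideal. -/
theorem card_residueField_eq (v : Place K) {A : Type*} [CommRing A] (g : A →+* K)
    (hg : ∀ a, v.val (g a) ≤ 1) (hd : ∀ x, v.val x ≤ 1 → ∃ a, v.val (g a - x) < 1)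
    (I : Ideal A) (hI : ∀ a, a ∈ I ↔ v.val (g a) < 1) :
    Nat.card v.residueField = Nat.card (A ⧸ I) := by
  have hlt : ∀ x : v.ring, IsLocalRing.residue v.ring x = 0 ↔ v.val x < 1 := by
    intro x
    rw [IsLocalRing.residue_eq_zero_iff]
    exact (HeightOneSpectrum.valuation_lt_one_iff_mem
      (IsDiscreteValuationRing.maximalIdeal v.ring) x).symm
  let f : A →+* v.residueField := (IsLocalRing.residue v.ring).comp
    (g.codRestrict v.ring fun a => (v.val_le_one_iff _).1 (hg a))
  have hf : Function.Surjective f := by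
    intro y
    obtain ⟨x, rfl⟩ := IsLocalRing.residue_surjective y
    obtain ⟨a, ha⟩ := hd x ((v.val_le_one_iff _).2 x.2)
    refine ⟨a, ?_⟩
    rw [← sub_eq_zero]
    change IsLocalRing.residue v.ring (g.codRestrict v.ring _ a) - _ = 0
    rw [← map_sub, hlt]
    exact ha
  have hk : RingHom.ker f = I := by
    ext a
    rw [RingHom.mem_ker, hI]
    exact hlt _
  rw [← hk]
  exact (Nat.card_congr (RingHom.quotientKerEquivOfSurjective hf).toEquiv).symm

/-! ### Classification of the places of `k(t)` -/

section RatFunc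

variable {k : Type*} [Field k]

/-- The finite place of `k(t)` attached to a nonzero prime of `k[t]`. -/
noncomputable def ofPrime (q : HeightOneSpectrum k[X]) : Place (RatFunc k) :=
  ofValuation (q.valuation (RatFunc k)) (q.valuation_surjective _)

theorem val_ofPrime (q : HeightOneSpectrum k[X]) : (ofPrime q).val = q.valuation (RatFunc k) :=
  val_ofValuation _ _

theorem ofPrime_injective : Function.Injective (ofPrime (k := k)) := by
  intro q q' h
  have h' := congrArg val h
  rw [val_ofPrime, val_ofPrime] at h'
  exact HeightOneSpectrum.eq_of_valuation_isEquiv_valuation (Valuation.IsEquiv.of_eq h')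

theorem isFinite_ofPrime (q : HeightOneSpectrum k[X]) : (ofPrime q).IsFinite := by
  intro f
  rw [← val_le_one_iff, val_ofPrime]
  exact q.valuation_le_one f

/-- Nonzero elements of a finite `k` are roots of unity, so every valuation is trivial on constants
and the classification of valuations of `k(t)` applies. -/
theorem IsFinite.exists_eq_ofPrime [Finite k] {v : Place (RatFunc k)} (hv : v.IsFinite) :
    ∃ q, ofPrime q = v := by
  have hX : v.val RatFunc.X ≤ 1 := by
    rw [val_le_one_iff, ← RatFunc.algebraMap_X]
    exact hv X
  obtain ⟨q, hq⟩ := RatFunc.valuation_isEquiv_adic_of_valuation_X_le_one hX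
  exact ⟨q, ofValuation_eq _ hq⟩

theorem card_residueField_ofPrime (q : HeightOneSpectrum k[X]) :
    Nat.card (ofPrime q).residueField = Nat.card (k[X] ⧸ q.asIdeal) := by
  refine card_residueField_eq _ (algebraMap k[X] (RatFunc k)) ?_ ?_ _ ?_
  · intro a
    rw [val_ofPrime]
    exact q.valuation_le_one a
  · intro x hx
    rw [val_ofPrime] at hx ⊢
    simpa using q.exists_valuation_sub_lt_of_integer hx 1
  · intro a
    rw [val_ofPrime, q.valuation_lt_one_iff_mem]

theorem card_quotient_span [Finite k] {f : k[X]} (hf : f ≠ 0) :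
    Nat.card (k[X] ⧸ Ideal.span {f}) = Nat.card k ^ f.natDegree := by
  have : Module.Finite k (k[X] ⧸ Ideal.span {f}) := by
    have := (AdjoinRoot.powerBasis hf).finite
    exact this
  rw [Module.natCard_eq_pow_finrank (K := k), finrank_quotient_span_eq_natDegree]

theorem card_residueField_ofPrime_ne_zero [Finite k] (q : HeightOneSpectrum k[X]) :
    Nat.card (ofPrime q).residueField ≠ 0 := by
  rw [card_residueField_ofPrime]
  obtain ⟨f, hf⟩ := IsPrincipalIdealRing.principal q.asIdeal
  have hf' : q.asIdeal = Ideal.span {f} := hf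
  have h0 : f ≠ 0 := by
    rintro rfl
    exact q.ne_bot (by simpa using hf')
  rw [hf', card_quotient_span h0]
  exact pow_ne_zero _ Nat.card_pos.ne'

theorem abs_ofPrime_of_notMem (q : HeightOneSpectrum k[X]) {f : k[X]} (hf : f ∉ q.asIdeal) :
    (ofPrime q).abs (algebraMap k[X] (RatFunc k) f) = 1 := by
  have h0 : f ≠ 0 := by
    rintro rfl
    exact hf (zero_mem _)
  rw [abs_of_ne_zero _ (by simpa using h0), val_ofPrime,
    q.valuation_eq_one_iff_notMem.2 hf]
  simp

theorem abs_ofPrime_of_span (q : HeightOneSpectrum k[X]) {f : k[X]} (h0 : f ≠ 0)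
    (hf : q.asIdeal = Ideal.span {f}) :
    (ofPrime q).abs (algebraMap k[X] (RatFunc k) f) =
      (Nat.card (k[X] ⧸ Ideal.span {f}) : ℝ)⁻¹ := by
  rw [abs_of_ne_zero _ (by simpa using h0), val_ofPrime, q.valuation_of_algebraMap,
    q.intValuation_singleton h0 hf, card_residueField_ofPrime, hf]
  simp

open Classical in
/-- The infinite place of `k(t)`. -/
noncomputable def infty (k : Type*) [Field k] : Place (RatFunc k) :=
  ofValuation (RatFunc.inftyValuation k) fun x => by
    induction x using WithZero.expRecOn with
    | zero => exact ⟨0, map_zero _⟩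
    | exp n => exact ⟨RatFunc.X ^ n, RatFunc.inftyValuation.X_zpow k n⟩

open Classical in
theorem val_infty : (infty k).val = RatFunc.inftyValuation k := val_ofValuation _ _

theorem isInfinite_infty : (infty k).IsInfinite := by
  classical
  intro h
  have := h X
  rw [← val_le_one_iff, val_infty, RatFunc.algebraMap_X, RatFunc.inftyValuation.X, ← exp_zero,
    exp_le_exp] at this
  omega

theorem IsInfinite.eq_infty [Finite k] {v : Place (RatFunc k)} (hv : v.IsInfinite) :
    v = infty k := by
  classical
  by_cases hX : v.val RatFunc.X ≤ 1
  · obtain ⟨q, hq⟩ := RatFunc.valuation_isEquiv_adic_of_valuation_X_le_one hX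
    have := ofValuation_eq (q.valuation_surjective _) hq
    exact absurd (this ▸ isFinite_ofPrime q) hv
  · exact (ofValuation_eq _
      (RatFunc.valuation_isEquiv_inftyValuation_of_one_lt_valuation_X (not_le.1 hX))).symm

/-- Constants represent all residues: a fraction of valuation `1` has numerator and denominator of
equal degree, and since the denominator is monic it is congruent to the leading coefficient of its
numerator. -/
theorem card_residueField_infty : Nat.card (infty k).residueField = Nat.card k := by
  classical
  rw [card_residueField_eq (infty k) (algebraMap k (RatFunc k)) ?_ ?_ ⊥ ?_]
  · exact Nat.card_congr (RingEquiv.quotientBot k).toEquiv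
  · intro a
    rw [val_infty]
    exact Valuation.IsTrivialOn.valuation_algebraMap_le_one _ a
  · intro x hx
    rw [val_infty] at hx ⊢
    by_cases hx1 : RatFunc.inftyValuation k x < 1
    · exact ⟨0, by simpa using hx1⟩
    have h1 : RatFunc.inftyValuation k x = 1 := le_antisymm hx (not_lt.1 hx1)
    have hx0 : x ≠ 0 := by
      rintro rfl
      simp at h1
    have hdeg : x.num.natDegree = x.denom.natDegree := by
      rw [RatFunc.inftyValuation_apply, RatFunc.inftyValuation_of_nonzero k hx0, ← exp_zero,
        exp_inj, RatFunc.intDegree] at h1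
      omega
    have hn : x.num ≠ 0 := RatFunc.num_ne_zero hx0
    have hd := x.denom_ne_zero
    have hl : x.num.leadingCoeff ≠ 0 := leadingCoeff_ne_zero.2 hn
    have hlt : (C x.num.leadingCoeff * x.denom - x.num).degree < x.denom.degree := by
      rw [← degree_C_mul (p := x.denom) hl]
      refine degree_sub_lt_left ?_ (mul_ne_zero (C_ne_zero.2 hl) hd) ?_
      · rw [degree_C_mul hl, degree_eq_natDegree hn, degree_eq_natDegree hd, hdeg]
      · rw [leadingCoeff_mul, leadingCoeff_C, (RatFunc.monic_denom x).leadingCoeff, mul_one]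
    refine ⟨x.num.leadingCoeff, ?_⟩
    have e : algebraMap k (RatFunc k) x.num.leadingCoeff - x =
        algebraMap k[X] (RatFunc k) (C x.num.leadingCoeff * x.denom - x.num) /
          algebraMap k[X] (RatFunc k) x.denom := by
      rw [eq_div_iff (by simpa using hd), sub_mul, map_sub, map_mul]
      congr 1
      nth_rewrite 1 [← RatFunc.num_div_denom x]
      rw [div_mul_cancel₀ _ (by simpa using hd)]
    rw [e]
    by_cases h0 : C x.num.leadingCoeff * x.denom - x.num = 0
    · simp [h0]
    · have hh := (map_ne_zero_iff _ (RatFunc.algebraMap_injective k)).2 h0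
      rw [RatFunc.inftyValuation_apply, RatFunc.inftyValuation_of_nonzero k
        (div_ne_zero hh (by simpa using hd)),
        RatFunc.intDegree_div hh (by simpa using hd),
        RatFunc.intDegree_polynomial, RatFunc.intDegree_polynomial, ← exp_zero, exp_lt_exp]
      have := natDegree_lt_natDegree h0 hlt
      omega
  · intro a
    rw [val_infty, Ideal.mem_bot]
    constructor
    · rintro rfl
      simp
    · intro h
      by_contra ha
      rw [Valuation.IsTrivialOn.eq_one a ha] at h
      exact lt_irrefl _ h

theorem abs_infty {f : k[X]} (hf : f ≠ 0) :
    (infty k).abs (algebraMap k[X] (RatFunc k) f) = (Nat.card k : ℝ) ^ f.natDegree := by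
  classical
  rw [abs_of_ne_zero _ (by simpa using hf), val_infty, card_residueField_infty,
    RatFunc.inftyValuation_apply, RatFunc.inftyValuation.polynomial k hf]
  simp

end RatFunc

end Place

/-! ### Cokernels as products of absolute values; the product formula -/

namespace Place

open IsDedekindDomain

variable {k : Type*} [Field k]

/-- The finite places of `k(t)` whose uniformizer does not act surjectively on `M`. -/
def nonDivisible (M : Type*) [AddCommGroup M] [Module k[X] M] : Set (HeightOneSpectrum k[X]) :=
  {q | ∀ π ∈ q.asIdeal, ¬ Function.Surjective fun m : M => π • m}

/-- The prime of `k[t]` generated by an irreducible polynomial. -/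
noncomputable def primeOf (π : k[X]) (hπ : Irreducible π) : HeightOneSpectrum k[X] where
  asIdeal := Ideal.span {π}
  isPrime := (Ideal.span_singleton_prime hπ.ne_zero).2 hπ.prime
  ne_bot := by simpa using hπ.ne_zero

theorem eq_primeOf {q : HeightOneSpectrum k[X]} {π : k[X]} (hπ : Irreducible π)
    (h : π ∈ q.asIdeal) : q = primeOf π hπ := by
  refine HeightOneSpectrum.ext ?_
  have hmax : (Ideal.span {π} : Ideal k[X]).IsMaximal :=
    PrincipalIdealRing.isMaximal_of_irreducible hπ
  exact (hmax.eq_of_le q.isPrime.ne_top ((Ideal.span_singleton_le_iff_mem _).2 h)).symm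

theorem abs_ofPrime_irreducible {π : k[X]} (hπ : Irreducible π) (q : HeightOneSpectrum k[X])
    (hq : q ≠ primeOf π hπ) : (ofPrime q).abs (algebraMap k[X] (RatFunc k) π) = 1 :=
  abs_ofPrime_of_notMem q fun h => hq (eq_primeOf hπ h)

theorem absOn_image_ofPrime (Q : Set (HeightOneSpectrum k[X])) (x : RatFunc k) :
    absOn (ofPrime '' Q) x = ∏ᶠ q ∈ Q, (ofPrime q).abs x :=
  finprod_mem_image ofPrime_injective.injOn

theorem finprod_mem_abs_inv (P : Set (Place (RatFunc k))) (x : RatFunc k) :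
    ∏ᶠ v ∈ P, (v.abs x)⁻¹ = (absOn P x)⁻¹ := by
  rw [absOn, ← finprod_inv_distrib]
  exact finprod_congr fun v => finprod_inv_distrib _

variable [Finite k]

theorem finite_setOf_abs_ofPrime_ne_one {f : k[X]} (hf : f ≠ 0) :
    {q | (ofPrime q).abs (algebraMap k[X] (RatFunc k) f) ≠ 1}.Finite := by
  induction f using UniqueFactorizationMonoid.induction_on_prime with
  | h₁ => exact absurd rfl hf
  | h₂ u hu =>
    convert Set.finite_empty
    ext q
    simp only [Set.mem_ofPred_eq, Set.mem_empty_iff_false, iff_false, not_not]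
    exact abs_ofPrime_of_notMem q fun h => q.isPrime.ne_top (Ideal.eq_top_of_isUnit_mem _ h hu)
  | h₃ f π hf0 hπ ih =>
    refine ((ih hf0).union (Set.finite_singleton (primeOf π hπ.irreducible))).subset ?_
    intro q hq
    by_contra hn
    simp only [Set.mem_union, Set.mem_ofPred_eq, Set.mem_singleton_iff, not_or, not_not] at hn
    apply hq
    rw [map_mul, abs_mul _ (by simpa using hπ.ne_zero) (by simpa using hf0)
      (card_residueField_ofPrime_ne_zero q), hn.1, mul_one]
    exact abs_ofPrime_irreducible _ _ hn.2

/-- The cokernel of a polynomial acting on a torsion-free module of rank at most one. -/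
theorem cokerCard_eq_finprod {M : Type*} [AddCommGroup M] [Module k[X] M]
    (h : IsRankLEOne k[X] M) {f : k[X]} (hf : f ≠ 0) :
    (cokerCard M f : ℝ) =
      ∏ᶠ q ∈ nonDivisible (k := k) M, ((ofPrime q).abs (algebraMap k[X] (RatFunc k) f))⁻¹ := by
  induction f using UniqueFactorizationMonoid.induction_on_prime with
  | h₁ => exact absurd rfl hf
  | h₂ u hu =>
    rw [cokerCard_eq_one_of_surjective, finprod_mem_congr (g := fun _ => 1) rfl, finprod_mem_one,
      Nat.cast_one]
    · intro q _
      rw [abs_ofPrime_of_notMem q fun h => q.isPrime.ne_top (Ideal.eq_top_of_isUnit_mem _ h hu),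
        inv_one]
    · obtain ⟨u, rfl⟩ := hu
      exact fun m => ⟨(u⁻¹ : k[X]ˣ) • m, by simp [Units.smul_def, smul_smul]⟩
  | h₃ f π hf0 hπ ih =>
    -- A `finprod` with infinite support defaults to `1`, so splitting it requires finite supports.
    have hfin : ∀ g : k[X], g ≠ 0 → (nonDivisible (k := k) M ∩ Function.mulSupport fun q =>
        ((ofPrime q).abs (algebraMap k[X] (RatFunc k) g))⁻¹).Finite := fun g hg =>
      (finite_setOf_abs_ofPrime_ne_one hg).subset fun q hq => by simpa using hq.2
    rw [cokerCard_mul (smul_injective_of_eq_zero_of_smul (h.eq_zero_of_smul _ · hπ.ne_zero)),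
      finprod_mem_congr (g := fun q => ((ofPrime q).abs (algebraMap k[X] (RatFunc k) π))⁻¹ *
        ((ofPrime q).abs (algebraMap k[X] (RatFunc k) f))⁻¹) rfl,
      finprod_mem_mul_distrib' (hfin _ hπ.ne_zero) (hfin _ hf0), Nat.cast_mul, ih hf0]
    · congr 1
      by_cases hs : Function.Surjective fun m : M => π • m
      · rw [cokerCard_eq_one_of_surjective hs, finprod_mem_congr (g := fun _ => 1) rfl,
          finprod_mem_one, Nat.cast_one]
        intro q hq
        rw [abs_ofPrime_irreducible hπ.irreducible, inv_one]
        rintro rfl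
        exact hq π (Ideal.mem_span_singleton_self π) hs
      · rw [h.cokerCard_eq_card_quotient hπ.irreducible hs,
          finprod_mem_inter_mulSupport_eq' _ _ {primeOf π hπ.irreducible}, finprod_mem_singleton,
          abs_ofPrime_of_span _ hπ.ne_zero rfl, inv_inv]
        intro q hq
        rw [Set.mem_singleton_iff]
        constructor
        · intro _
          by_contra hne
          exact hq (by simp [abs_ofPrime_irreducible hπ.irreducible q hne])
        -- If some multiple of `π` were surjective, then `π` would be too.
        · rintro rfl ρ hρ hρs
          obtain ⟨c, rfl⟩ := Ideal.mem_span_singleton.1 hρ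
          refine hs fun m => ?_
          obtain ⟨n, hn⟩ := hρs m
          exact ⟨c • n, by simpa [mul_smul] using hn⟩
    · intro q _
      rw [map_mul, abs_mul _ (by simpa using hπ.ne_zero) (by simpa using hf0)
        (card_residueField_ofPrime_ne_zero q), mul_inv]

theorem finite_setOf_abs_ne_one {f : k[X]} (hf : f ≠ 0) :
    {v : Place (RatFunc k) | v.abs (algebraMap k[X] (RatFunc k) f) ≠ 1}.Finite := by
  refine (((finite_setOf_abs_ofPrime_ne_one hf).image ofPrime).union
    (Set.finite_singleton (infty k))).subset ?_
  intro v hv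
  by_cases h : v.IsFinite
  · obtain ⟨q, rfl⟩ := h.exists_eq_ofPrime
    exact Or.inl ⟨q, hv, rfl⟩
  · exact Or.inr (IsInfinite.eq_infty h)

/-- This is the cokernel formula for `M = k[X]`: no element of a proper ideal acts surjectively, so
all primes occur, and the cokernel is `k[X]/(f)`. -/
theorem finprod_abs_ofPrime_inv {f : k[X]} (hf : f ≠ 0) :
    ∏ᶠ q, ((ofPrime q).abs (algebraMap k[X] (RatFunc k) f))⁻¹ =
      (Nat.card k : ℝ) ^ f.natDegree := by
  have hrank : IsRankLEOne k[X] k[X] :=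
    ⟨fun a m ha h => (mul_eq_zero.1 h).resolve_left ha, fun x y => by
      by_cases hx : x = 0
      · exact ⟨1, 0, by simp, by simp [hx]⟩
      · exact ⟨y, x, Or.inr hx, by simp [mul_comm]⟩⟩
  have huniv : nonDivisible (k := k) k[X] = Set.univ := by
    refine Set.eq_univ_of_forall fun q π hπ hs => ?_
    obtain ⟨g, hg⟩ := hs 1
    exact q.isPrime.ne_top (Ideal.eq_top_of_isUnit_mem _ hπ (IsUnit.of_mul_eq_one g hg))
  have h := cokerCard_eq_finprod hrank hf
  rw [huniv, finprod_mem_univ] at h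
  have hrange : (DistribSMul.toAddMonoidHom k[X] f).range =
      (Ideal.span {f} : Ideal k[X]).toAddSubgroup := by
    ext x
    simp only [AddMonoidHom.mem_range, Submodule.mem_toAddSubgroup, Ideal.mem_span_singleton]
    exact ⟨fun ⟨y, hy⟩ => ⟨y, hy.symm⟩, fun ⟨y, hy⟩ => ⟨y, hy.symm⟩⟩
  rw [← h, ← Nat.cast_pow, ← card_quotient_span hf, cokerCard, AddSubgroup.index_eq_card, hrange]
  rfl

theorem abs_ne_zero (v : Place (RatFunc k)) {f : k[X]} (hf : f ≠ 0) :
    v.abs (algebraMap k[X] (RatFunc k) f) ≠ 0 := by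
  rw [abs_of_ne_zero _ (by simpa using hf)]
  refine zpow_ne_zero _ ?_
  by_cases h : v.IsFinite
  · obtain ⟨q, rfl⟩ := h.exists_eq_ofPrime
    exact_mod_cast card_residueField_ofPrime_ne_zero q
  · rw [IsInfinite.eq_infty h, card_residueField_infty]
    exact_mod_cast Nat.card_pos.ne'

theorem absOn_ne_zero (P : Set (Place (RatFunc k))) {f : k[X]} (hf : f ≠ 0) :
    absOn P (algebraMap k[X] (RatFunc k) f) ≠ 0 :=
  finprod_mem_induction (· ≠ 0) one_ne_zero (fun _ _ => mul_ne_zero) fun v _ => abs_ne_zero v hf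

/-- The product formula for `k(t)`. -/
theorem absOn_univ {f : k[X]} (hf : f ≠ 0) :
    absOn Set.univ (algebraMap k[X] (RatFunc k) f) = 1 := by
  have hu : (Set.univ : Set (Place (RatFunc k))) = ofPrime '' Set.univ ∪ {infty k} := by
    refine (Set.eq_univ_of_forall fun v => ?_).symm
    by_cases h : v.IsFinite
    · obtain ⟨q, rfl⟩ := h.exists_eq_ofPrime
      exact Or.inl ⟨q, trivial, rfl⟩
    · exact Or.inr (IsInfinite.eq_infty h)
  have hd : Disjoint (ofPrime '' Set.univ) {infty k} := by
    rw [Set.disjoint_singleton_right]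
    rintro ⟨q, -, hq⟩
    exact isInfinite_infty (hq ▸ isFinite_ofPrime q)
  have hfin : ∀ s : Set (Place (RatFunc k)), (s ∩ Function.mulSupport fun v =>
      v.abs (algebraMap k[X] (RatFunc k) f)).Finite := fun s =>
    (finite_setOf_abs_ne_one hf).subset fun v hv => hv.2
  -- The infinite place contributes `|k| ^ deg f`, which is the inverse of the product over the
  -- finite places.
  rw [absOn, hu, finprod_mem_union' hd (hfin _) (hfin _), finprod_mem_singleton, abs_infty hf,
    ← finprod_abs_ofPrime_inv hf, finprod_inv_distrib]
  change absOn _ _ * _ = 1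
  rw [absOn_image_ofPrime, finprod_mem_univ]
  refine mul_inv_cancel₀ ?_
  have := absOn_ne_zero (ofPrime '' Set.univ) hf
  rwa [absOn_image_ofPrime, finprod_mem_univ] at this

theorem absOn_compl (P : Set (Place (RatFunc k))) {f : k[X]} (hf : f ≠ 0) :
    absOn Pᶜ (algebraMap k[X] (RatFunc k) f) = (absOn P (algebraMap k[X] (RatFunc k) f))⁻¹ := by
  have hfin : ∀ s : Set (Place (RatFunc k)), (s ∩ Function.mulSupport fun v =>
      v.abs (algebraMap k[X] (RatFunc k) f)).Finite := fun s =>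
    (finite_setOf_abs_ne_one hf).subset fun v hv => hv.2
  refine eq_inv_of_mul_eq_one_left ?_
  rw [← absOn_univ hf, ← Set.compl_union_self P]
  exact (finprod_mem_union' disjoint_compl_left (hfin _) (hfin _)).symm

/-- The cokernel of a polynomial acting on a torsion-free module of rank at most one, in terms of
absolute values. -/
theorem cokerCard_eq_absOn_inv {M : Type*} [AddCommGroup M] [Module k[X] M]
    (h : IsRankLEOne k[X] M) {f : k[X]} (hf : f ≠ 0) :
    (cokerCard M f : ℝ) =
      (absOn (ofPrime '' nonDivisible (k := k) M) (algebraMap k[X] (RatFunc k) f))⁻¹ := by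
  rw [cokerCard_eq_finprod h hf, absOn_image_ofPrime, ← finprod_inv_distrib]
  exact finprod_congr fun v => finprod_inv_distrib _

end Place

/-! ### Functions of `j` that are products over places -/

/-- A set of finite places of a rational function field `𝔽_p(t)`. -/
structure FinitePlaceSet where
  /-- the characteristic -/
  p : ℕ
  prime : Fact p.Prime
  /-- the places -/
  places : Set (Place (RatFunc (ZMod p)))
  isFinite : ∀ v ∈ places, v.IsFinite

attribute [instance] FinitePlaceSet.prime

/-- `|t ^ j - 1|⁻¹` on a set of finite places. -/
noncomputable def FinitePlaceSet.count (D : FinitePlaceSet) (j : ℕ) : ℝ :=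
  (Place.absOn D.places (RatFunc.X ^ j - 1))⁻¹

/-- The function `c` is a finite product of functions `j ↦ |t ^ j - 1|_P⁻¹`. -/
def IsPlaceProduct (c : ℕ → ℕ) : Prop :=
  ∃ L : List FinitePlaceSet, ∀ j, 1 ≤ j → (c j : ℝ) = (L.map fun D => D.count j).prod

theorem IsPlaceProduct.mul {c d e : ℕ → ℕ} (hc : IsPlaceProduct c) (hd : IsPlaceProduct d)
    (he : ∀ j, 1 ≤ j → e j = c j * d j) : IsPlaceProduct e := by
  obtain ⟨L, hL⟩ := hc
  obtain ⟨L', hL'⟩ := hd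
  exact ⟨L ++ L', fun j hj => by
    rw [he j hj, Nat.cast_mul, hL j hj, hL' j hj, List.map_append, List.prod_append]⟩

theorem IsPlaceProduct.of_eq_one {c : ℕ → ℕ} (hc : ∀ j, 1 ≤ j → c j = 1) : IsPlaceProduct c :=
  ⟨[], fun j hj => by simp [hc j hj]⟩

theorem X_pow_sub_one_ne_zero {A : Type*} [CommRing A] [IsDomain A] {j : ℕ} (hj : 1 ≤ j) :
    (X ^ j - 1 : A[X]) ≠ 0 := by
  rw [← C_1]
  exact X_pow_sub_C_ne_zero hj 1

theorem RatFunc.algebraMap_X_pow_sub_one {k : Type*} [Field k] (j : ℕ) :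
    algebraMap k[X] (RatFunc k) (Polynomial.X ^ j - 1) = RatFunc.X ^ j - 1 := by
  simp

theorem IsRankLEOne.isPlaceProduct {p : ℕ} [hp : Fact p.Prime] {M : Type*} [AddCommGroup M]
    [Module (ZMod p)[X] M] (h : IsRankLEOne (ZMod p)[X] M) :
    IsPlaceProduct fun j => cokerCard M (X ^ j - 1 : (ZMod p)[X]) := by
  refine ⟨[⟨p, hp, Place.ofPrime '' Place.nonDivisible (k := ZMod p) M, ?_⟩], fun j hj => ?_⟩
  · rintro _ ⟨q, -, rfl⟩
    exact Place.isFinite_ofPrime q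
  · rw [Place.cokerCard_eq_absOn_inv h (X_pow_sub_one_ne_zero hj),
      RatFunc.algebraMap_X_pow_sub_one]
    simp [FinitePlaceSet.count]

/-! ### Filtration of torsion-free modules by saturations -/

section Saturation

variable {A : Type*} [CommRing A] [IsDomain A] {M : Type*} [AddCommGroup M] [Module A M]

/-- The elements having a nonzero multiple in the submodule `N`. -/
def Submodule.saturation (N : Submodule A M) : Submodule A M where
  carrier := {y | ∃ f : A, f ≠ 0 ∧ f • y ∈ N}
  zero_mem' := ⟨1, one_ne_zero, by simp⟩
  add_mem' := by
    rintro y z ⟨f, hf, hy⟩ ⟨g, hg, hz⟩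
    refine ⟨f * g, mul_ne_zero hf hg, ?_⟩
    rw [smul_add, mul_smul, mul_smul, smul_comm f g y]
    exact N.add_mem (N.smul_mem _ hy) (N.smul_mem _ hz)
  smul_mem' := by
    rintro a y ⟨f, hf, hy⟩
    exact ⟨f, hf, by rw [smul_comm]; exact N.smul_mem _ hy⟩

theorem Submodule.mem_saturation_of_smul {N : Submodule A M} {a : A} (ha : a ≠ 0) {y : M}
    (h : a • y ∈ N.saturation) : y ∈ N.saturation := by
  obtain ⟨f, hf, hy⟩ := h
  exact ⟨f * a, mul_ne_zero hf ha, by rwa [mul_smul]⟩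

theorem isRankLEOne_of_le_saturation (htf : ∀ (a : A) (m : M), a ≠ 0 → a • m = 0 → m = 0) (x : M)
    (L : Submodule A M) (hL : L ≤ (Submodule.span A {x}).saturation) : IsRankLEOne A L where
  eq_zero_of_smul a m ha h := Subtype.ext (htf a m ha (congrArg Subtype.val h))
  exists_smul_eq y z := by
    obtain ⟨f, hf, hy⟩ := hL y.2
    obtain ⟨g, hg, hz⟩ := hL z.2
    obtain ⟨a, ha⟩ := Submodule.mem_span_singleton.1 hy
    obtain ⟨b, hb⟩ := Submodule.mem_span_singleton.1 hz
    by_cases h0 : a = 0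
    · refine ⟨1, 0, Or.inl one_ne_zero, ?_⟩
      rw [h0, zero_smul] at ha
      rw [one_smul, zero_smul]
      exact Subtype.ext (htf f y hf ha.symm)
    · refine ⟨b * f, a * g, Or.inr (mul_ne_zero h0 hg), Subtype.ext ?_⟩
      change (b * f) • (y : M) = (a * g) • (z : M)
      rw [mul_smul, mul_smul, ← ha, ← hb, smul_smul, smul_smul, mul_comm]

end Saturation

/-- A torsion-free `𝔽_p[t]`-module of finite rank is an iterated extension of modules of rank at
most one. -/
theorem isPlaceProduct_of_torsionFree {p : ℕ} [hp : Fact p.Prime] (r : ℕ) :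
    ∀ (M : Type*) [AddCommGroup M] [Module (ZMod p)[X] M]
      (_ : ∀ (a : (ZMod p)[X]) (m : M), a ≠ 0 → a • m = 0 → m = 0) (x : Fin r → M)
      (_ : ∀ y, y ∈ (Submodule.span (ZMod p)[X] (Set.range x)).saturation),
      IsPlaceProduct fun j => cokerCard M (X ^ j - 1 : (ZMod p)[X]) := by
  induction r with
  | zero =>
    intro M _ _ htf x hx
    refine IsPlaceProduct.of_eq_one fun j _ => cokerCard_eq_one_of_surjective fun m => ⟨0, ?_⟩
    obtain ⟨f, hf, hm⟩ := hx m
    rw [Set.range_eq_empty, Submodule.span_empty, Submodule.mem_bot] at hm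
    simp [htf f m hf hm]
  | succ r ih =>
    intro M _ _ htf x hx
    -- Saturating makes `M ⧸ L` torsion-free, and the images of the other `r` elements span it up to
    -- torsion.
    let L := (Submodule.span (ZMod p)[X] {x 0}).saturation
    have htf' : ∀ (a : (ZMod p)[X]) (m : M ⧸ L), a ≠ 0 → a • m = 0 → m = 0 := by
      intro a m ha h
      obtain ⟨m, rfl⟩ := L.mkQ_surjective m
      rw [← map_smul, Submodule.mkQ_apply, Submodule.Quotient.mk_eq_zero] at h
      rw [Submodule.mkQ_apply, Submodule.Quotient.mk_eq_zero]
      exact Submodule.mem_saturation_of_smul ha h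
    have h1 : IsRankLEOne (ZMod p)[X] (LinearMap.ker L.mkQ) :=
      isRankLEOne_of_le_saturation htf (x 0) _ (Submodule.ker_mkQ L).le
    refine IsPlaceProduct.mul h1.isPlaceProduct
      (ih (M ⧸ L) htf' (fun i => L.mkQ (x i.succ)) fun y => ?_)
      fun j hj => cokerCard_eq_ker_mul L.mkQ L.mkQ_surjective
        (smul_injective_of_eq_zero_of_smul (htf' _ · (X_pow_sub_one_ne_zero hj)))
    obtain ⟨y, rfl⟩ := L.mkQ_surjective y
    obtain ⟨f, hf, hy⟩ := hx y
    refine ⟨f, hf, ?_⟩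
    rw [← map_smul]
    have := Submodule.mem_map_of_mem (f := L.mkQ) hy
    rw [Submodule.map_span] at this
    refine Submodule.span_le.2 ?_ this
    rintro _ ⟨_, ⟨i, rfl⟩, rfl⟩
    refine Fin.cases ?_ (fun i => ?_) i
    · have : L.mkQ (x 0) = 0 := by
        rw [Submodule.mkQ_apply, Submodule.Quotient.mk_eq_zero]
        exact ⟨1, one_ne_zero, by simp⟩
      rw [this]
      exact zero_mem _
    · exact Submodule.subset_span ⟨i, rfl⟩

/-! ### From `ℤ[t]`-modules killed by `p` to `𝔽_p[t]`-modules -/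

theorem map_castRingHom_eq_zero_iff {p : ℕ} (f : ℤ[X]) :
    f.map (Int.castRingHom (ZMod p)) = 0 ↔ C (p : ℤ) ∣ f := by
  rw [C_dvd_iff_dvd_coeff, Polynomial.ext_iff]
  simp [ZMod.intCast_zmod_eq_zero_iff_dvd]

/-- The `𝔽_p[t]`-module structure on a `ℤ[t]`-module killed by `p`. -/
theorem exists_module_zmod {p : ℕ} [Fact p.Prime] {M : Type*} [AddCommGroup M] [Module ℤ[X] M]
    (hM : ∀ m : M, (C (p : ℤ) : ℤ[X]) • m = 0) :
    ∃ _ : Module (ZMod p)[X] M,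
      ∀ (f : ℤ[X]) (m : M), f.map (Int.castRingHom (ZMod p)) • m = f • m := by
  have hs : Function.Surjective (mapRingHom (Int.castRingHom (ZMod p))) :=
    map_surjective _ ZMod.intCast_surjective
  have hker : RingHom.ker (mapRingHom (Int.castRingHom (ZMod p))) ≤
      RingHom.ker (Module.toAddMonoidEnd ℤ[X] M) := by
    intro f hf
    rw [RingHom.mem_ker, coe_mapRingHom, map_castRingHom_eq_zero_iff] at hf
    obtain ⟨h, rfl⟩ := hf
    rw [RingHom.mem_ker]
    ext m
    change (C (p : ℤ) * h) • m = 0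
    rw [mul_smul, hM]
  let g := RingHom.liftOfSurjective (mapRingHom (Int.castRingHom (ZMod p))) hs
    ⟨Module.toAddMonoidEnd ℤ[X] M, hker⟩
  refine ⟨Module.compHom M g, fun f m => ?_⟩
  have := RingHom.liftOfRightInverse_comp_apply (mapRingHom (Int.castRingHom (ZMod p))) _
    (Function.rightInverse_surjInv hs) ⟨Module.toAddMonoidEnd ℤ[X] M, hker⟩ f
  exact DFunLike.congr_fun this m

theorem isPlaceProduct_of_torsionFree_mod {p : ℕ} [hp : Fact p.Prime] {M : Type*}
    [AddCommGroup M] [Module ℤ[X] M] (hM : ∀ m : M, (C (p : ℤ) : ℤ[X]) • m = 0)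
    (htf : ∀ (f : ℤ[X]) (m : M), ¬ C (p : ℤ) ∣ f → f • m = 0 → m = 0)
    (H : Submodule ℤ[X] M) (hH : H.FG)
    (hfr : ∀ m : M, ∃ f : ℤ[X], ¬ C (p : ℤ) ∣ f ∧ f • m ∈ H) :
    IsPlaceProduct fun j => cokerCard M (X ^ j - 1 : ℤ[X]) := by
  obtain ⟨_, hsmul⟩ := exists_module_zmod hM
  have hs : Function.Surjective (Polynomial.map (Int.castRingHom (ZMod p))) :=
    map_surjective _ ZMod.intCast_surjective
  have hcoker : ∀ j, cokerCard M (X ^ j - 1 : ℤ[X]) = cokerCard M (X ^ j - 1 : (ZMod p)[X]) := by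
    intro j
    rw [cokerCard, cokerCard]
    congr 2
    ext m
    change (X ^ j - 1 : ℤ[X]) • m = (X ^ j - 1 : (ZMod p)[X]) • m
    rw [← hsmul, Polynomial.map_sub, Polynomial.map_pow, map_X, Polynomial.map_one]
  obtain ⟨r, x, rfl⟩ := Submodule.fg_iff_exists_fin_generating_family.1 hH
  simp only [hcoker]
  refine isPlaceProduct_of_torsionFree r M ?_ x ?_
  · intro a m ha h
    obtain ⟨f, rfl⟩ := hs a
    rw [hsmul] at h
    exact htf f m (by rwa [← map_castRingHom_eq_zero_iff]) h
  · intro m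
    obtain ⟨f, hf, hm⟩ := hfr m
    refine ⟨f.map (Int.castRingHom (ZMod p)), by rwa [Ne, map_castRingHom_eq_zero_iff], ?_⟩
    rw [hsmul]
    refine Submodule.span_induction (p := fun y _ => y ∈ Submodule.span (ZMod p)[X] (Set.range x))
      (fun y hy => Submodule.subset_span hy) (zero_mem _) (fun _ _ _ _ => add_mem)
      (fun a y _ hy => ?_) hm
    rw [← hsmul]
    exact Submodule.smul_mem _ _ hy

/-! ### Dévissage along the exponent -/

/-- A `ℤ[t]`-module on which every `t ^ j - 1` acts injectively, whose `p`-torsion is for every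
prime `p` a torsion-free `𝔽_p[t]`-module of finite rank. -/
structure HasFiniteRankTorsion (M : Type*) [AddCommGroup M] [Module ℤ[X] M] : Prop where
  eq_zero_of_smul : ∀ p : ℕ, p.Prime → ∀ (f : ℤ[X]) (m : M), ¬ C (p : ℤ) ∣ f →
    (C (p : ℤ) : ℤ[X]) • m = 0 → f • m = 0 → m = 0
  exists_fg : ∀ p : ℕ, p.Prime → ∃ H : Submodule ℤ[X] M, H.FG ∧
    ∀ m : M, (C (p : ℤ) : ℤ[X]) • m = 0 → ∃ f : ℤ[X], ¬ C (p : ℤ) ∣ f ∧ f • m ∈ H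
  injective : ∀ j, 1 ≤ j → Function.Injective fun m : M => (X ^ j - 1 : ℤ[X]) • m

/-- The rank condition descends because `ℤ[t]` is Noetherian: the part of `H` inside `N` is again
finitely generated. -/
theorem HasFiniteRankTorsion.submodule {M : Type*} [AddCommGroup M] [Module ℤ[X] M]
    (h : HasFiniteRankTorsion M) (N : Submodule ℤ[X] M) : HasFiniteRankTorsion N where
  eq_zero_of_smul p hp f m hf h1 h2 := Subtype.ext
    (h.eq_zero_of_smul p hp f m hf (congrArg Subtype.val h1) (congrArg Subtype.val h2))
  exists_fg p hp := by
    obtain ⟨H, hH, hfr⟩ := h.exists_fg p hp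
    refine ⟨H.comap N.subtype, ?_, fun m hm => hfr m (congrArg Subtype.val hm)⟩
    refine Submodule.fg_of_fg_map_injective N.subtype N.injective_subtype ?_
    have : IsNoetherian ℤ[X] H := isNoetherian_of_fg_of_noetherian H hH
    exact hH.of_le (Submodule.map_comap_le _ _)
  injective j hj x y hxy := Subtype.ext (h.injective j hj (congrArg Subtype.val hxy))

/-- Each prime factor `p` of `N` splits off `M[p]`. The quotient `pM` is again a submodule of `M`,
so it inherits the hypotheses, and it is killed by `N / p`. -/
theorem HasFiniteRankTorsion.isPlaceProduct (N : ℕ) :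
    ∀ (M : Type*) [AddCommGroup M] [Module ℤ[X] M] (_ : HasFiniteRankTorsion M)
      (_ : 0 < N) (_ : ∀ m : M, (C (N : ℤ) : ℤ[X]) • m = 0),
      IsPlaceProduct fun j => cokerCard M (X ^ j - 1 : ℤ[X]) := by
  induction N using induction_on_primes with
  | zero => exact fun M _ _ _ h => absurd h (lt_irrefl 0)
  | one =>
    intro M _ _ _ _ hN
    refine IsPlaceProduct.of_eq_one fun j _ => cokerCard_eq_one_of_surjective fun m => ⟨0, ?_⟩
    simpa using (hN m).symm
  | prime_mul p a hp ih =>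
    intro M _ _ h hpos hN
    let q := (LinearMap.lsmul ℤ[X] M (C (p : ℤ))).rangeRestrict
    have hfact : Fact p.Prime := ⟨hp⟩
    have hker : ∀ m : LinearMap.ker q, (C (p : ℤ) : ℤ[X]) • m = 0 := fun m =>
      Subtype.ext (show (C (p : ℤ) : ℤ[X]) • (m : M) = 0 from
        congrArg Subtype.val (LinearMap.mem_ker.1 m.2))
    have hk := h.submodule (LinearMap.ker q)
    obtain ⟨H, hH, hfr⟩ := hk.exists_fg p hp
    have h1 := isPlaceProduct_of_torsionFree_mod hker
      (fun f m hf => hk.eq_zero_of_smul p hp f m hf (hker m)) H hH (fun m => hfr m (hker m))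
    have hr := h.submodule (LinearMap.range (LinearMap.lsmul ℤ[X] M (C (p : ℤ))))
    refine h1.mul (ih _ hr (Nat.pos_of_mul_pos_left hpos) ?_) fun j hj =>
      cokerCard_eq_ker_mul q (LinearMap.surjective_rangeRestrict _) (hr.injective j hj)
    rintro ⟨_, m, rfl⟩
    refine Subtype.ext ?_
    have := hN m
    rw [Nat.cast_mul, C_mul, mul_comm, mul_smul] at this
    exact this

/-! ### Finite rank from the base change to the residue field -/

section BaseChange

open scoped TensorProduct

variable {R : Type*} [CommRing R] {M : Type*} [AddCommGroup M] [Module R M]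

/-- The kernel of `M → Frac (R / 𝔭) ⊗ M`. -/
theorem exists_smul_mem_of_tmul_eq_zero (𝔭 : Ideal R) [h𝔭 : 𝔭.IsPrime] {m : M}
    (hm : (1 : FractionRing (R ⧸ 𝔭)) ⊗ₜ[R] m = 0) :
    ∃ f ∉ 𝔭, f • m ∈ (𝔭 • ⊤ : Submodule R M) := by
  let S := nonZeroDivisors (R ⧸ 𝔭)
  let T := LocalizedModule S (M ⧸ (𝔭 • ⊤ : Submodule R M))
  let ι : (M ⧸ (𝔭 • ⊤ : Submodule R M)) →ₗ[R ⧸ 𝔭] T := LocalizedModule.mkLinearMap S _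
  let q := (𝔭 • ⊤ : Submodule R M).mkQ
  -- This balanced map induces a map from the tensor product to the localization of `M/𝔭M` that
  -- sends `1 ⊗ m` to the class of `m`; its vanishing there gives a multiplier outside `𝔭`.
  let b : FractionRing (R ⧸ 𝔭) →+ M →+ T :=
    AddMonoidHom.mk' (fun k => AddMonoidHom.mk' (fun m => k • ι (q m))
      fun x y => by rw [map_add, map_add, smul_add])
      fun x y => by ext m; exact add_smul x y _
  have hb : ∀ (r : R) (k : FractionRing (R ⧸ 𝔭)) (m : M), b (r • k) m = b k (r • m) := by
    intro r k m
    change (r • k) • ι (q m) = k • ι (q (r • m))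
    have h1 : r • k = algebraMap (R ⧸ 𝔭) (FractionRing (R ⧸ 𝔭)) (Ideal.Quotient.mk 𝔭 r) * k := by
      rw [Algebra.smul_def]
      rfl
    have h2 : q (r • m) = Ideal.Quotient.mk 𝔭 r • q m := rfl
    rw [h1, h2, map_smul, mul_comm, mul_smul, algebraMap_smul]
  have h0 := congrArg (TensorProduct.liftAddHom b hb) hm
  rw [TensorProduct.liftAddHom_tmul, map_zero] at h0
  change (1 : FractionRing (R ⧸ 𝔭)) • ι (q m) = 0 at h0
  rw [one_smul, IsLocalizedModule.eq_zero_iff S] at h0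
  obtain ⟨⟨c, hc⟩, hcm⟩ := h0
  obtain ⟨f, rfl⟩ := Ideal.Quotient.mk_surjective c
  refine ⟨f, fun hf => ?_, ?_⟩
  · exact nonZeroDivisors.ne_zero hc (Ideal.Quotient.eq_zero_iff_mem.2 hf)
  · exact (Submodule.Quotient.mk_eq_zero _).1 hcm

/-- Finitely many `1 ⊗ m` span over the fraction field. Clearing denominators in an expression of `1
⊗ m` gives `1 ⊗ (f • m - h) = 0` with `h ∈ H`, and the kernel is `𝔭M` up to multipliers outside `𝔭`.
-/
theorem exists_fg_of_finite_tensorProduct (𝔭 : Ideal R) [h𝔭 : 𝔭.IsPrime]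
    [Module.Finite (FractionRing (R ⧸ 𝔭)) (TensorProduct R (FractionRing (R ⧸ 𝔭)) M)] :
    ∃ H : Submodule R M, H.FG ∧ ∀ m : M, ∃ f ∉ 𝔭, f • m ∈ H ⊔ 𝔭 • ⊤ := by
  classical
  let K := FractionRing (R ⧸ 𝔭)
  have hspan : Submodule.span K (Set.range fun m : M => (1 : K) ⊗ₜ[R] m) = ⊤ := by
    refine Submodule.eq_top_iff'.2 fun z => ?_
    induction z with
    | zero => exact zero_mem _
    | add x y hx hy => exact add_mem hx hy
    | tmul k m =>
      have : k ⊗ₜ[R] m = k • ((1 : K) ⊗ₜ[R] m) := by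
        rw [TensorProduct.smul_tmul', smul_eq_mul, mul_one]
      rw [this]
      exact Submodule.smul_mem _ _ (Submodule.subset_span ⟨m, rfl⟩)
  have hfg : (Submodule.span K (Set.range fun m : M => (1 : K) ⊗ₜ[R] m)).FG :=
    hspan ▸ Module.Finite.fg_top
  obtain ⟨s, hs, hs'⟩ := (Submodule.fg_span_iff_fg_span_finset_subset _).1 hfg
  obtain ⟨t, rfl⟩ : ∃ t : Finset M, t.image (fun m : M => (1 : K) ⊗ₜ[R] m) = s := by
    rw [← Set.image_univ] at hs
    obtain ⟨t, -, ht⟩ := Finset.subset_set_image_iff.1 hs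
    exact ⟨t, ht⟩
  refine ⟨Submodule.span R t, ⟨t, rfl⟩, fun m => ?_⟩
  have key : ∀ z ∈ Submodule.span K
      ((t.image (fun m : M => (1 : K) ⊗ₜ[R] m) : Finset _) : Set (TensorProduct R K M)),
      ∃ f ∉ 𝔭, ∃ h ∈ Submodule.span R (t : Set M), f • z = (1 : K) ⊗ₜ[R] h := by
    intro z hz
    induction hz using Submodule.span_induction with
    | mem z hz =>
      obtain ⟨m, hm, rfl⟩ := Finset.mem_image.1 hz
      exact ⟨1, h𝔭.one_notMem, m, Submodule.subset_span hm, one_smul _ _⟩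
    | zero => exact ⟨1, h𝔭.one_notMem, 0, zero_mem _, by simp⟩
    | add x y _ _ hx hy =>
      obtain ⟨f, hf, h, hh, e⟩ := hx
      obtain ⟨f', hf', h', hh', e'⟩ := hy
      refine ⟨f * f', fun hff => (h𝔭.mem_or_mem hff).elim hf hf', f' • h + f • h',
        add_mem (Submodule.smul_mem _ _ hh) (Submodule.smul_mem _ _ hh'), ?_⟩
      rw [smul_add, mul_smul, mul_smul, smul_comm f f' x, e, e', TensorProduct.tmul_add,
        TensorProduct.tmul_smul, TensorProduct.tmul_smul]
    | smul k x _ hx =>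
      obtain ⟨f, hf, h, hh, e⟩ := hx
      obtain ⟨a, b, hb, rfl⟩ := IsFractionRing.div_surjective (R ⧸ 𝔭) k
      obtain ⟨a, rfl⟩ := Ideal.Quotient.mk_surjective a
      obtain ⟨b, rfl⟩ := Ideal.Quotient.mk_surjective b
      have hb0 : b ∉ 𝔭 := fun hf =>
        nonZeroDivisors.ne_zero hb (Ideal.Quotient.eq_zero_iff_mem.2 hf)
      have hbK : algebraMap (R ⧸ 𝔭) K (Ideal.Quotient.mk 𝔭 b) ≠ 0 :=
        IsFractionRing.to_map_ne_zero_of_mem_nonZeroDivisors hb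
      refine ⟨b * f, fun hff => (h𝔭.mem_or_mem hff).elim hb0 hf, a • h,
        Submodule.smul_mem _ _ hh, ?_⟩
      have halg : ∀ (r : R) (z : TensorProduct R K M),
          algebraMap (R ⧸ 𝔭) K (Ideal.Quotient.mk 𝔭 r) • z = r • z := fun r z =>
        algebraMap_smul K r z
      rw [mul_smul, smul_comm f, e, ← halg b, smul_smul, mul_div_cancel₀ _ hbK, halg,
        TensorProduct.tmul_smul]
  obtain ⟨f, hf, h, hh, e⟩ := key ((1 : K) ⊗ₜ[R] m) (by rw [← hs', hspan]; trivial)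
  rw [← TensorProduct.tmul_smul, ← sub_eq_zero, ← TensorProduct.tmul_sub] at e
  obtain ⟨g, hg, hgm⟩ := exists_smul_mem_of_tmul_eq_zero 𝔭 e
  refine ⟨g * f, fun hff => (h𝔭.mem_or_mem hff).elim hg hf, ?_⟩
  rw [smul_sub, ← mul_smul] at hgm
  rw [← sub_add_cancel ((g * f) • m) (g • h), sup_comm]
  exact Submodule.add_mem_sup hgm (Submodule.smul_mem _ _ hh)

/-- Nakayama's lemma for a nilpotent principal ideal, up to elements outside a prime ideal. -/
theorem exists_smul_eq_add_pow_smul {π : R} [h𝔭 : (Ideal.span {π}).IsPrime] {H : Submodule R M}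
    (hH : ∀ m : M, ∃ f ∉ Ideal.span {π}, f • m ∈ H ⊔ Ideal.span {π} • ⊤) (n : ℕ) (m : M) :
    ∃ f ∉ Ideal.span {π}, ∃ h ∈ H, ∃ m' : M, f • m = h + π ^ n • m' := by
  induction n with
  | zero => exact ⟨1, h𝔭.one_notMem, 0, zero_mem _, m, by simp⟩
  | succ n ih =>
    obtain ⟨f, hf, h, hh, m', e⟩ := ih
    obtain ⟨g, hg, hgm⟩ := hH m'
    obtain ⟨h', hh', y, hy, e'⟩ := Submodule.mem_sup.1 hgm
    rw [Submodule.ideal_span_singleton_smul] at hy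
    obtain ⟨y, -, rfl⟩ := hy
    refine ⟨g * f, fun hff => (h𝔭.mem_or_mem hff).elim hg hf, g • h + π ^ n • h',
      add_mem (Submodule.smul_mem _ _ hh) (Submodule.smul_mem _ _ hh'), y, ?_⟩
    rw [mul_smul, e, smul_add, smul_comm g, ← e', smul_add, add_assoc, pow_succ, mul_smul]
    rfl

end BaseChange

/-! ### Consequences of the conditions on associated primes -/

theorem prime_C_natCast {p : ℕ} (hp : p.Prime) : Prime (C (p : ℤ) : ℤ[X]) :=
  Polynomial.prime_C_iff.2 (Nat.prime_iff_prime_int.1 hp)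

/-- A principal associated prime that contains the annihilator of a `p`-torsion element. -/
theorem exists_mem_associatedPrimes {M : Type*} [AddCommGroup M] [Module ℤ[X] M]
    (hass : ∀ 𝔭 ∈ associatedPrimes ℤ[X] M, 𝔭.IsPrincipal) {p : ℕ} (hp : p.Prime) {m : M}
    (hm : m ≠ 0) (hpm : (C (p : ℤ) : ℤ[X]) • m = 0) :
    Ideal.span {(C (p : ℤ) : ℤ[X])} ∈ associatedPrimes ℤ[X] M ∧
      ∀ f : ℤ[X], f • m = 0 → C (p : ℤ) ∣ f := by
  obtain ⟨𝔮, h𝔮, hle⟩ := exists_le_isAssociatedPrime_of_isNoetherianRing ℤ[X] m hm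
  have hle' : ∀ f : ℤ[X], f • m = 0 → f ∈ 𝔮 := fun f hf => hle (by simpa using hf)
  obtain ⟨g, hg⟩ := hass 𝔮 h𝔮
  have hg' : 𝔮 = Ideal.span {g} := hg
  have hdvd : g ∣ C (p : ℤ) := by
    rw [← Ideal.mem_span_singleton, ← hg']
    exact hle' _ hpm
  have hu : ¬ IsUnit g := by
    rw [← Ideal.span_singleton_eq_top, ← hg']
    exact h𝔮.isPrime.ne_top
  -- `p` is irreducible in `ℤ[t]`, so its non-unit divisor `g` is associated to it.
  have hassoc : Associated (C (p : ℤ)) g :=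
    (((prime_C_natCast hp).irreducible.dvd_iff.1 hdvd).resolve_left hu)
  have h : 𝔮 = Ideal.span {(C (p : ℤ) : ℤ[X])} := by
    rw [hg', Ideal.span_singleton_eq_span_singleton]
    exact hassoc.symm
  refine ⟨h ▸ h𝔮, fun f hf => ?_⟩
  rw [← Ideal.mem_span_singleton, ← h]
  exact hle' f hf

theorem hasFiniteRankTorsion {M : Type*} [AddCommGroup M] [Module ℤ[X] M]
    {N : ℕ} (hN : 0 < N) (hexp : ∀ m : M, (C (N : ℤ) : ℤ[X]) • m = 0)
    (hass : ∀ 𝔭 ∈ associatedPrimes ℤ[X] M, 𝔭.IsPrincipal)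
    (hinj : ∀ j, 1 ≤ j → Function.Injective fun m : M => (X ^ j - 1 : ℤ[X]) • m)
    (hdim : ∀ 𝔭 ∈ associatedPrimes ℤ[X] M, Module.Finite (FractionRing (ℤ[X] ⧸ 𝔭))
      (TensorProduct ℤ[X] (FractionRing (ℤ[X] ⧸ 𝔭)) M)) : HasFiniteRankTorsion M where
  eq_zero_of_smul p hp f m hf hpm hfm := by
    by_contra hm
    exact hf ((exists_mem_associatedPrimes hass hp hm hpm).2 f hfm)
  exists_fg p hp := by
    by_cases h : ∃ m : M, m ≠ 0 ∧ (C (p : ℤ) : ℤ[X]) • m = 0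
    · obtain ⟨m, hm, hpm⟩ := h
      have hmem := (exists_mem_associatedPrimes hass hp hm hpm).1
      have := hdim _ hmem
      have hprime : (Ideal.span {(C (p : ℤ) : ℤ[X])}).IsPrime := hmem.isPrime
      obtain ⟨H, hH, hfr⟩ := exists_fg_of_finite_tensorProduct (M := M)
        (Ideal.span {(C (p : ℤ) : ℤ[X])})
      refine ⟨H, hH, fun y _ => ?_⟩
      -- Write `N = p ^ n * N'` with `p ∤ N'`. Then `N'` lies outside `(p)` and kills the error term
      -- in `p ^ n M`.
      obtain ⟨n, N', hN', rfl⟩ := Nat.exists_eq_pow_mul_and_not_dvd hN.ne' p hp.ne_one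
      obtain ⟨f, hf, h, hh, y', e⟩ := exists_smul_eq_add_pow_smul hfr n y
      refine ⟨C (N' : ℤ) * f, fun hd => ?_, ?_⟩
      · rcases (prime_C_natCast hp).dvd_or_dvd hd with hd | hd
        · rw [Polynomial.C_dvd_iff_dvd_coeff] at hd
          have := hd 0
          rw [coeff_C_zero] at this
          exact hN' (by exact_mod_cast this)
        · exact hf (Ideal.mem_span_singleton.2 hd)
      · have h0 := hexp y'
        rw [Nat.cast_mul, Nat.cast_pow, C_mul, C_pow, mul_comm, mul_smul] at h0
        rw [mul_smul, e, smul_add, h0, add_zero]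
        exact H.smul_mem _ hh
    · push Not at h
      refine ⟨⊥, Submodule.fg_bot, fun m hm => ⟨1, ?_, ?_⟩⟩
      · exact fun hd => (prime_C_natCast hp).not_isUnit (isUnit_of_dvd_one hd)
      · rw [one_smul, Submodule.mem_bot]
        by_contra h0
        exact h m h0 hm
  injective := hinj

/-! ### Reidemeister numbers as cokernel orders, and the theorem -/

/-- The Reidemeister number is the index of the image of `φ - 1`. -/
theorem reidemeisterNumber_eq {G : Type*} [AddCommGroup G] (φ : AddMonoid.End G)
    (h : (φ - 1).range.index ≠ 0) : reidemeisterNumber φ = (φ - 1).range.index := by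
  have e : ReidemeisterClass φ ≃ G ⧸ (φ - 1).range := by
    refine Quotient.congr (Equiv.refl G) fun a b => ?_
    rw [QuotientAddGroup.leftRel_apply]
    constructor
    · rintro ⟨g, rfl⟩
      refine ⟨-g, ?_⟩
      change φ (-g) - -g = -a + (g + a + φ (-g))
      abel
    · rintro ⟨g, hg⟩
      refine ⟨-g, ?_⟩
      have hg' : φ g - g = -a + b := hg
      rw [neg_neg, eq_comm, ← sub_eq_zero]
      rw [eq_comm, ← sub_eq_zero] at hg'
      rw [← neg_eq_zero, ← hg']
      abel
  have : (φ - 1).range.FiniteIndex := ⟨h⟩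
  have : Finite (G ⧸ (φ - 1).range) := AddSubgroup.finite_quotient_of_finiteIndex
  have : Finite (ReidemeisterClass φ) := Finite.of_equiv _ e.symm
  rw [reidemeisterNumber, ENat.card_eq_coe_natCard, Nat.card_congr e, AddSubgroup.index_eq_card]

theorem cokerCard_polyModule {G : Type*} [AddCommGroup G] (φ : AddMonoid.End G) (j : ℕ) :
    cokerCard (PolyModule φ) (X ^ j - 1 : ℤ[X]) = (φ ^ j - 1).range.index := by
  let e : G ≃+ PolyModule φ := (Module.AEval'.of (addMonoidEndRingEquivInt G φ)).toAddEquiv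
  have hX : ∀ g, ((X : ℤ[X]) ^ j - 1) • e g = e ((φ ^ j - 1) g) := by
    intro g
    rw [sub_smul, one_smul]
    have h1 : (X : ℤ[X]) ^ j • e g = e ((φ ^ j) g) := by
      refine (Module.AEval'.X_pow_smul_of (addMonoidEndRingEquivInt G φ) g j).trans ?_
      have h2 : addMonoidEndRingEquivInt G φ ^ j = addMonoidEndRingEquivInt G (φ ^ j) :=
        (map_pow _ _ _).symm
      rw [h2]
      rfl
    rw [h1, ← map_sub]
    rfl
  have hmap : (DistribSMul.toAddMonoidHom (PolyModule φ) (X ^ j - 1 : ℤ[X])).range =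
      (φ ^ j - 1).range.map (e : G →+ PolyModule φ) := by
    ext x
    constructor
    · rintro ⟨y, rfl⟩
      obtain ⟨g, rfl⟩ := e.surjective y
      exact ⟨_, ⟨g, rfl⟩, (hX g).symm⟩
    · rintro ⟨_, ⟨g, rfl⟩, rfl⟩
      exact ⟨e g, hX g⟩
  rw [cokerCard, hmap, AddSubgroup.index_map_equiv]

theorem theorem1p1 {G : Type*} [AddCommGroup G] (φ : AddMonoid.End G)
    (hφ : Function.Bijective φ)
    -- `G` is a non-finitely generated torsion group, of bounded exponent
    (htors : ∀ g : G, IsOfFinAddOrder g)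
    (hexp : ∃ N : ℕ, 0 < N ∧ ∀ g : G, N • g = 0)
    (hfg : ¬ AddGroup.FG G)
    -- (1) finitely many associated primes, all of them nonzero principal ideals
    (hfin : (associatedPrimes ℤ[X] (PolyModule φ)).Finite)
    (hass : ∀ 𝔭 ∈ associatedPrimes ℤ[X] (PolyModule φ),
      𝔭 ≠ ⊥ ∧ 𝔭.IsPrincipal)
    -- (2) `t ^ j - 1` acts injectively for all `j ≥ 1`
    (hinj : ∀ j : ℕ, 1 ≤ j → Function.Injective
      (fun g : PolyModule φ => ((X : ℤ[X]) ^ j - 1) • g))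
    -- (3) `G ⊗ 𝕂(𝔭)` is finite-dimensional over `𝕂(𝔭) = Frac (ℤ[t] / 𝔭)`
    (hdim : ∀ 𝔭 ∈ associatedPrimes ℤ[X] (PolyModule φ),
      Module.Finite (FractionRing (ℤ[X] ⧸ 𝔭))
        (TensorProduct ℤ[X] (FractionRing (ℤ[X] ⧸ 𝔭)) (PolyModule φ))) :
    ∃ (n : ℕ) (p : Fin n → ℕ) (_ : ∀ i, Fact (p i).Prime)
      (P Pinf S : ∀ i, Set (Place (RatFunc (ZMod (p i))))),
      (∀ i, ∀ v ∈ P i, v.IsFinite) ∧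
      (∀ i, ∀ v ∈ Pinf i, v.IsInfinite) ∧
      (∀ i, ∀ v ∈ S i, v.IsFinite) ∧
      (∀ i, S i = (Pinf i ∪ P i)ᶜ) ∧
      ∀ j : ℕ, 1 ≤ j →
        -- almost all factors of the products below are `1`
        (∀ i, {v : Place (RatFunc (ZMod (p i))) | v.abs (RatFunc.X ^ j - 1) ≠ 1}.Finite) ∧
        ∃ r : ℕ,
          reidemeisterNumber (φ ^ j) = r ∧
          (r : ℝ) = ∏ i, ∏ᶠ v ∈ P i, (v.abs (RatFunc.X ^ j - 1))⁻¹ ∧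
          (r : ℝ) = ∏ i, (Place.absOn (P i) (RatFunc.X ^ j - 1))⁻¹ ∧
          (r : ℝ) = ∏ i, Place.absOn (Pinf i ∪ S i) (RatFunc.X ^ j - 1) := by
  obtain ⟨N, hN, hNG⟩ := hexp
  have hNG' : ∀ m : PolyModule φ, (C (N : ℤ) : ℤ[X]) • m = 0 := by
    intro m
    obtain ⟨g, rfl⟩ := (Module.AEval'.of (addMonoidEndRingEquivInt G φ)).surjective m
    have : (C (N : ℤ) : ℤ[X]) = ((N : ℕ) : ℤ[X]) := by simp
    rw [this, Nat.cast_smul_eq_nsmul, ← map_nsmul, hNG, map_zero]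
  have hM := hasFiniteRankTorsion hN hNG' (fun 𝔭 h => (hass 𝔭 h).2) hinj hdim
  obtain ⟨L, hL⟩ := hM.isPlaceProduct N _ hN hNG'
  let D := fun i : Fin L.length => L[i]
  -- `Pinf i` consists of all infinite places and `S i` of the finite places outside `P i`, so their
  -- union is the complement of `P i`.
  refine ⟨L.length, fun i => (D i).p, fun i => (D i).prime, fun i => (D i).places,
    fun i => {v | v.IsInfinite}, fun i => {v | v.IsFinite} \ (D i).places,
    fun i => (D i).isFinite, fun i v hv => hv, fun i v hv => hv.1, fun i => ?_, fun j hj => ?_⟩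
  · ext v
    simp [Place.IsInfinite]
  have hprod : (cokerCard (PolyModule φ) (X ^ j - 1 : ℤ[X]) : ℝ) =
      ∏ i, (Place.absOn (D i).places (RatFunc.X ^ j - 1))⁻¹ := by
    rw [hL j hj, ← Fin.prod_univ_fun_getElem]
    rfl
  have hcompl : ∀ i, {v : Place (RatFunc (ZMod (D i).p)) | v.IsInfinite} ∪
      ({v | v.IsFinite} \ (D i).places) = (D i).placesᶜ := by
    intro i
    ext v
    have := (D i).isFinite v
    simp only [Place.IsInfinite, Set.mem_union, Set.mem_ofPred_eq, Set.mem_sdiff, Set.mem_compl_iff]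
    tauto
  refine ⟨fun i => ?_, _, ?_, hprod.trans ?_, hprod, hprod.trans ?_⟩
  · rw [← RatFunc.algebraMap_X_pow_sub_one]
    exact Place.finite_setOf_abs_ne_one (X_pow_sub_one_ne_zero hj)
  · rw [cokerCard_polyModule]
    -- An infinite cokernel would have index `0`, whereas no factor of the product vanishes.
    refine reidemeisterNumber_eq _ fun h0 => ?_
    rw [cokerCard_polyModule, h0, Nat.cast_zero, eq_comm, Finset.prod_eq_zero_iff] at hprod
    obtain ⟨i, -, hi⟩ := hprod
    rw [← RatFunc.algebraMap_X_pow_sub_one] at hi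
    exact inv_ne_zero (Place.absOn_ne_zero _ (X_pow_sub_one_ne_zero hj)) hi
  · exact Finset.prod_congr rfl fun i _ => (Place.finprod_mem_abs_inv _ _).symm
  · refine Finset.prod_congr rfl fun i _ => ?_
    rw [hcompl, ← RatFunc.algebraMap_X_pow_sub_one]
    exact (Place.absOn_compl _ (X_pow_sub_one_ne_zero hj)).symm
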